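/- Let $E\subset\mathbb C^N$ be compact. An admissible weight on $E$ is an upper semicontinuous function $w:E\to[0,\infty)$ such that $\{z\in E: w(z)>0\}$ is not pluripolar. Put $Q:=-\log w$ (with $Q=+\infty$ where $w=0$), and define the weighted pluricomplex Green function $$V_{E,Q}(z):=\sup\{u(z)\;:\;u\in\mathcal L,\ u\le Q\text{ on }E\},\qquad z\in\mathbb C^N,$$ where $\mathcal L$ is the class of plurisubharmonic functions $u$ on $\mathbb C^N$ for which there is a constant $C$ with $u(z)\le\log^+|z|+C$ for all $z\in\mathbb C^N$. Let $w_1,w_2,\dots$ and $w$ be admissible weights on $E$ such that, for every $z\in E$, the sequence $(w_j(z))_j$ is decreasing (not necessarily strictly) and converges to $w(z)$. Put $Q_j:=-\log w_j$ and $Q:=-\log w$. Then $$\lim_{j\to\infty}V_{E,Q_j}(z)=V_{E,Q}(z)\qquad\text{for every }z\in\mathbb C^N.$$ -/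

import Mathlib

open MeasureTheory Set Filter Topology

noncomputable section

/-- The integral `∫ f dμ = ∫ f⁺ dμ - ∫ f⁻ dμ` of an extended-real-valued function. It is used below
only for upper semicontinuous `f < ∞` on a circle, so that `∫ f⁺ dμ` is finite and the value lies
in `[-∞, ∞)`. -/
def erealIntegral {α : Type*} [MeasurableSpace α] (f : α → EReal) (μ : Measure α) : EReal :=
  ((∫⁻ x, (f x).toENNReal ∂μ : ENNReal) : EReal) - ((∫⁻ x, (-f x).toENNReal ∂μ : ENNReal) : EReal)

/-- The normalized arc-length measure `dθ / 2π` on `(0, 2π]`. -/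
def normalizedAngleMeasure : Measure ℝ :=
  (ENNReal.ofReal (2 * Real.pi))⁻¹ • volume.restrict (Ioc 0 (2 * Real.pi))

/-- The mean value `(1 / 2π) ∫₀^{2π} u (a + e^{iθ} b) dθ` of `u` over the boundary of the complex
disc with centre `a` and radius vector `b`. -/
def discMean {N : ℕ} (u : EuclideanSpace ℂ (Fin N) → EReal) (a b : EuclideanSpace ℂ (Fin N)) :
    EReal :=
  erealIntegral (fun θ : ℝ => u (a + Complex.exp (θ * Complex.I) • b)) normalizedAngleMeasure

/-- `u` is plurisubharmonic on the (open) set `U`: it has values in `[-∞, ∞)`, is upper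
semicontinuous, is not identically `-∞` on any connected component of `U`, and satisfies the
sub-mean value inequality on every closed complex disc contained in `U`. -/
structure IsPSHOn {N : ℕ} (u : EuclideanSpace ℂ (Fin N) → EReal)
    (U : Set (EuclideanSpace ℂ (Fin N))) : Prop where
  lt_top : ∀ z ∈ U, u z < ⊤
  usc : UpperSemicontinuousOn u U
  not_identically_bot : ∀ z ∈ U, ∃ y ∈ connectedComponentIn U z, u y ≠ ⊥
  le_discMean : ∀ a b : EuclideanSpace ℂ (Fin N),
    (∀ t : ℂ, ‖t‖ ≤ 1 → a + t • b ∈ U) → u a ≤ discMean u a b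

/-- A set is pluripolar if locally, near each of its points, it lies in the `-∞` set of a
plurisubharmonic function. -/
def IsPluripolar {N : ℕ} (S : Set (EuclideanSpace ℂ (Fin N))) : Prop :=
  ∀ a ∈ S, ∃ U : Set (EuclideanSpace ℂ (Fin N)), IsOpen U ∧ a ∈ U ∧
    ∃ v : EuclideanSpace ℂ (Fin N) → EReal, IsPSHOn v U ∧ ∀ z ∈ S ∩ U, v z = ⊥

/-- The Lelong class of plurisubharmonic functions on `ℂ^N` with `u z ≤ log⁺ |z| + C`. -/
def lelongClass (N : ℕ) : Set (EuclideanSpace ℂ (Fin N) → EReal) :=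
  {u | IsPSHOn u univ ∧ ∃ C : ℝ, ∀ z, u z ≤ ((Real.posLog ‖z‖ + C : ℝ) : EReal)}

/-- Admissible weight functions on `E`; only the values of `w` on `E` matter. -/
structure IsAdmissibleWeight {N : ℕ} (E : Set (EuclideanSpace ℂ (Fin N)))
    (w : EuclideanSpace ℂ (Fin N) → ℝ) : Prop where
  nonneg : ∀ z ∈ E, 0 ≤ w z
  usc : UpperSemicontinuousOn w E
  not_pluripolar : ¬ IsPluripolar {z ∈ E | 0 < w z}

/-- `Q = -log w`, with values in `(-∞, ∞]`; it is `+∞` where `w = 0`. -/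
def weightPotential {N : ℕ} (w : EuclideanSpace ℂ (Fin N) → ℝ) :
    EuclideanSpace ℂ (Fin N) → EReal :=
  fun z => -ENNReal.log (ENNReal.ofReal (w z))

/-- The weighted pluricomplex Green function
`V_{E,Q} (z) = sup {u z | u in the Lelong class, u ≤ Q on E}`. -/
def weightedGreen {N : ℕ} (E : Set (EuclideanSpace ℂ (Fin N)))
    (Q : EuclideanSpace ℂ (Fin N) → EReal) : EuclideanSpace ℂ (Fin N) → EReal :=
  fun z => ⨆ u ∈ {u ∈ lelongClass N | ∀ x ∈ E, u x ≤ Q x}, u z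

end

/-!
The statement is a Dini theorem. The potentials `Q_j = -log w_j` are lower semicontinuous on `E`,
bounded below by no more than `-∞ < Q_j`, and increase pointwise to `Q`. If `u` is a competitor for
`V_{E,Q}` and `ε > 0`, then `u - ε < Q` wherever `u` is finite, so the relatively open sets
`{u - ε < Q_j}` increase with `j` and cover the compact set `E`; one of them is all of `E`
(`exists_forall_sub_le_of_tendsto`). The Lelong class is stable under subtraction of constants
(`sub_mem_lelongClass`), so `u - ε` is a competitor for `V_{E,Q_j}`. Letting `ε → 0`, every value
`u z` is at most `sup_j V_{E,Q_j} z`; the reverse inequality is monotonicity in the potential.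

The only computation is that subtracting a constant `ε` lowers an extended-real mean value by at
most `ε`, which is `erealIntegral_sub_le`.
-/

open MeasureTheory Set Filter Topology

/-- With `g = x - ε`, this is `x⁺ + g⁻ ≤ g⁺ + x⁻ + ε`: the inequality `x - ε ≤ g⁺ - g⁻` written
without subtraction, so that it survives infinite values and integration. -/
theorem toENNReal_add_toENNReal_neg_sub_le (x : EReal) {ε : ℝ} (hε : 0 ≤ ε) :
    x.toENNReal + (-(x - ε)).toENNReal ≤
      (x - ε).toENNReal + (-x).toENNReal + ENNReal.ofReal ε := by
  induction x with
  | bot => simp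
  | top => simp
  | coe r =>
    rw [← EReal.coe_sub, ← EReal.coe_neg, ← EReal.coe_neg]
    simp only [EReal.toENNReal_of_ne_top (EReal.coe_ne_top _), EReal.toReal_coe]
    have hmax : ∀ t : ℝ, ENNReal.ofReal t = ENNReal.ofReal (max t 0) := fun t => by
      simp [ENNReal.ofReal_max]
    rw [hmax r, hmax (-(r - ε)), hmax (r - ε), hmax (-r),
      ← ENNReal.ofReal_add (by positivity) (by positivity),
      ← ENNReal.ofReal_add (by positivity) (by positivity),
      ← ENNReal.ofReal_add (by positivity) hε]
    apply ENNReal.ofReal_le_ofReal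
    linarith [max_zero_sub_max_neg_zero_eq_self r, max_zero_sub_max_neg_zero_eq_self (r - ε)]

theorem toENNReal_neg_sub_le (x : EReal) (ε : ℝ) :
    (-(x - ε)).toENNReal ≤ (-x).toENNReal + ENNReal.ofReal ε := by
  induction x with
  | bot => simp
  | top => simp
  | coe r =>
    rw [← EReal.coe_sub, ← EReal.coe_neg, ← EReal.coe_neg]
    simp only [EReal.toENNReal_of_ne_top (EReal.coe_ne_top _), EReal.toReal_coe]
    rw [show -(r - ε) = -r + ε by ring]
    exact ENNReal.ofReal_add_le

/-- No integrability is assumed: if the negative part of `f` has infinite integral, the left-hand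
side is `-∞`, by the convention `⊤ - ⊤ = ⊥`. -/
theorem erealIntegral_sub_le {α : Type*} [MeasurableSpace α] {μ : Measure α}
    [IsProbabilityMeasure μ] {f : α → EReal} (hf : Measurable f) {ε : ℝ} (hε : 0 ≤ ε) :
    erealIntegral f μ - ε ≤ erealIntegral (fun x => f x - ε) μ := by
  unfold erealIntegral
  have hfn : Measurable fun x => (-f x).toENNReal := hf.neg.ereal_toENNReal
  have hg : Measurable fun x => (f x - ε).toENNReal := (hf.sub measurable_const).ereal_toENNReal
  have hsum : ∫⁻ x, (f x).toENNReal ∂μ + ∫⁻ x, (-(f x - ε)).toENNReal ∂μ ≤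
      ∫⁻ x, (f x - ε).toENNReal ∂μ + ∫⁻ x, (-f x).toENNReal ∂μ + ENNReal.ofReal ε := by
    rw [← lintegral_add_left hf.ereal_toENNReal, ← lintegral_add_left hg]
    calc _ ≤ ∫⁻ x, ((f x - ε).toENNReal + (-f x).toENNReal + ENNReal.ofReal ε) ∂μ :=
          lintegral_mono fun x => toENNReal_add_toENNReal_neg_sub_le (f x) hε
      _ = _ := by rw [lintegral_add_right _ measurable_const]; simp
  have hneg : ∫⁻ x, (-(f x - ε)).toENNReal ∂μ ≤
      ∫⁻ x, (-f x).toENNReal ∂μ + ENNReal.ofReal ε := by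
    calc _ ≤ ∫⁻ x, ((-f x).toENNReal + ENNReal.ofReal ε) ∂μ :=
          lintegral_mono fun x => toENNReal_neg_sub_le (f x) ε
      _ = _ := by rw [lintegral_add_right _ measurable_const]; simp
  generalize ∫⁻ x, (f x).toENNReal ∂μ = A at *
  generalize ∫⁻ x, (-f x).toENNReal ∂μ = B at *
  generalize ∫⁻ x, (f x - ε).toENNReal ∂μ = A' at *
  generalize ∫⁻ x, (-(f x - ε)).toENNReal ∂μ = B' at *
  rcases eq_or_ne B ⊤ with rfl | hB
  · simp
  have hB' : B' ≠ ⊤ := ne_top_of_le_ne_top (by simp [hB]) hneg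
  lift B to NNReal using hB
  lift B' to NNReal using hB'
  rcases eq_or_ne A' ⊤ with rfl | hA'
  · simp
  have hA : A ≠ ⊤ := ne_top_of_le_ne_top (by simp [hA']) (le_self_add.trans hsum)
  lift A to NNReal using hA
  lift A' to NNReal using hA'
  rw [ENNReal.ofReal] at hsum
  norm_cast at hsum
  have h : (A : ℝ) + B' ≤ A' + B + ε := by
    have := NNReal.coe_le_coe.2 hsum
    simpa [Real.coe_toNNReal _ hε] using this
  have h' : (A : ℝ) - B - ε ≤ A' - B' := by linarith
  simp only [EReal.coe_nnreal_eq_coe_real]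
  exact_mod_cast h'

instance isProbabilityMeasure_normalizedAngleMeasure :
    IsProbabilityMeasure normalizedAngleMeasure where
  measure_univ := by
    have h : ENNReal.ofReal (2 * Real.pi) ≠ 0 := by simp [Real.pi_pos]
    simp only [normalizedAngleMeasure, Measure.smul_apply, Measure.restrict_apply_univ,
      Real.volume_Ioc, sub_zero, smul_eq_mul]
    exact ENNReal.inv_mul_cancel h ENNReal.ofReal_ne_top

theorem upperSemicontinuousOn_sub_coe {α : Type*} [TopologicalSpace α] {u : α → EReal} {s : Set α}
    (hu : UpperSemicontinuousOn u s) (ε : ℝ) :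
    UpperSemicontinuousOn (fun x => u x - ε) s := by
  intro x hx c hc
  have hiff : ∀ y, u y - ε < c ↔ u y < c + ε := fun y =>
    EReal.sub_lt_iff (.inl (EReal.coe_ne_bot _)) (.inl (EReal.coe_ne_top _))
  simp only [hiff] at hc ⊢
  exact hu x hx _ hc

variable {N : ℕ}

theorem sub_mem_lelongClass {u : EuclideanSpace ℂ (Fin N) → EReal} (hu : u ∈ lelongClass N)
    {ε : ℝ} (hε : 0 ≤ ε) : (fun z => u z - ε) ∈ lelongClass N := by
  obtain ⟨hpsh, C, hC⟩ := hu
  have hle : ∀ z, u z - ε ≤ u z := fun z =>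
    EReal.sub_le_of_le_add (le_add_of_nonneg_right (by exact_mod_cast hε))
  refine ⟨⟨fun z hz => (hle z).trans_lt (hpsh.lt_top z hz),
    upperSemicontinuousOn_sub_coe hpsh.usc ε, fun z hz => ?_, fun a b hab => ?_⟩,
    C, fun z => (hle z).trans (hC z)⟩
  · obtain ⟨y, hy, hne⟩ := hpsh.not_identically_bot z hz
    refine ⟨y, hy, ?_⟩
    rw [sub_eq_add_neg, ← EReal.coe_neg]
    exact EReal.add_ne_bot_iff.2 ⟨hne, EReal.coe_ne_bot _⟩
  · have hcont : Continuous fun θ : ℝ => a + Complex.exp (θ * Complex.I) • b := by fun_prop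
    have husc : UpperSemicontinuous fun θ : ℝ => u (a + Complex.exp (θ * Complex.I) • b) :=
      (upperSemicontinuousOn_univ_iff.1 hpsh.usc).comp hcont
    exact (EReal.sub_le_sub (hpsh.le_discMean a b hab) le_rfl).trans
      (erealIntegral_sub_le husc.measurable hε)

/-- One-sided Dini theorem: an upper semicontinuous function below the limit of an increasing
sequence of lower semicontinuous functions on a compact set lies, up to `ε`, below one of them. -/
theorem exists_forall_sub_le_of_tendsto {α : Type*} [TopologicalSpace α] {E : Set α}
    (hE : IsCompact E) {u Q : α → EReal} {Qj : ℕ → α → EReal} (hu : UpperSemicontinuousOn u E)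
    (hu_top : ∀ x ∈ E, u x ≠ ⊤) (hQj : ∀ j, LowerSemicontinuousOn (Qj j) E)
    (hQj_bot : ∀ j, ∀ x ∈ E, Qj j x ≠ ⊥) (hmono : ∀ x ∈ E, Monotone fun j => Qj j x)
    (hlim : ∀ x ∈ E, Tendsto (fun j => Qj j x) atTop (𝓝 (Q x))) (huQ : ∀ x ∈ E, u x ≤ Q x)
    {ε : ℝ} (hε : 0 < ε) : ∃ j, ∀ x ∈ E, u x - ε ≤ Qj j x := by
  suffices h : ∃ j, ∀ x ∈ E, x ∈ E → u x - ε ≤ Qj j x from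
    h.imp fun j hj x hx => hj x hx hx
  refine hE.induction_on (p := fun s => ∃ j, ∀ x ∈ s, x ∈ E → u x - ε ≤ Qj j x) ⟨0, by simp⟩
    (fun s t hst ⟨j, hj⟩ => ⟨j, fun x hx => hj x (hst hx)⟩) ?_ fun x hx => ?_
  · rintro s t ⟨j, hj⟩ ⟨k, hk⟩
    refine ⟨max j k, fun x hx hxE => ?_⟩
    rcases hx with hx | hx
    · exact (hj x hx hxE).trans (hmono x hxE (le_max_left j k))
    · exact (hk x hx hxE).trans (hmono x hxE (le_max_right j k))
  · obtain ⟨j, hj⟩ : ∃ j, u x - ε < Qj j x := by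
      rcases eq_or_ne (u x) ⊥ with hbot | hbot
      · exact ⟨0, by simpa [hbot, bot_lt_iff_ne_bot] using hQj_bot 0 x hx⟩
      · have hlt : u x - ε < u x := by
          lift u x to ℝ using ⟨hu_top x hx, hbot⟩ with r
          exact_mod_cast sub_lt_self r hε
        exact ((hlim x hx).eventually_const_lt (hlt.trans_le (huQ x hx))).exists
    obtain ⟨c, huc, hcQ⟩ := exists_between hj
    refine ⟨_, (upperSemicontinuousOn_sub_coe hu ε x hx c huc).and (hQj j x hx c hcQ),
      j, fun y hy _ => (hy.1.trans hy.2).le⟩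

theorem antitone_neg_log_ofReal : Antitone fun t : ℝ => -ENNReal.log (ENNReal.ofReal t) :=
  fun _ _ h => EReal.neg_le_neg_iff.2 (ENNReal.log_monotone (ENNReal.ofReal_le_ofReal h))

theorem continuous_neg_log_ofReal : Continuous fun t : ℝ => -ENNReal.log (ENNReal.ofReal t) :=
  continuous_neg.comp (ENNReal.continuous_log.comp ENNReal.continuous_ofReal)

theorem weightPotential_ne_bot (w : EuclideanSpace ℂ (Fin N) → ℝ) (z : EuclideanSpace ℂ (Fin N)) :
    weightPotential w z ≠ ⊥ := by
  rw [weightPotential, Ne, EReal.neg_eq_bot_iff, ENNReal.log_eq_top_iff]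
  exact ENNReal.ofReal_ne_top

theorem lowerSemicontinuousOn_weightPotential {E : Set (EuclideanSpace ℂ (Fin N))}
    {w : EuclideanSpace ℂ (Fin N) → ℝ} (hw : UpperSemicontinuousOn w E) :
    LowerSemicontinuousOn (weightPotential w) E :=
  continuous_neg_log_ofReal.comp_upperSemicontinuousOn_antitone hw antitone_neg_log_ofReal

theorem weightedGreen_mono {E : Set (EuclideanSpace ℂ (Fin N))}
    {Q Q' : EuclideanSpace ℂ (Fin N) → EReal} (h : ∀ x ∈ E, Q x ≤ Q' x)
    (z : EuclideanSpace ℂ (Fin N)) : weightedGreen E Q z ≤ weightedGreen E Q' z :=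
  biSup_mono fun _ hu => ⟨hu.1, fun x hx => (hu.2 x hx).trans (h x hx)⟩

theorem corollary2p2 (N : ℕ) (E : Set (EuclideanSpace ℂ (Fin N))) (hE : IsCompact E)
    (w : EuclideanSpace ℂ (Fin N) → ℝ) (hw : IsAdmissibleWeight E w)
    (wj : ℕ → EuclideanSpace ℂ (Fin N) → ℝ) (hwj : ∀ j, IsAdmissibleWeight E (wj j))
    (hdecr : ∀ z ∈ E, Antitone (fun j => wj j z))
    (hlim : ∀ z ∈ E, Tendsto (fun j => wj j z) atTop (𝓝 (w z))) :
    ∀ z, Tendsto (fun j => weightedGreen E (weightPotential (wj j)) z) atTop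
      (𝓝 (weightedGreen E (weightPotential w) z)) := by
  intro z
  have hmono : ∀ x ∈ E, Monotone fun j => weightPotential (wj j) x := fun x hx =>
    antitone_neg_log_ofReal.comp (hdecr x hx)
  have hlimQ : ∀ x ∈ E,
      Tendsto (fun j => weightPotential (wj j) x) atTop (𝓝 (weightPotential w x)) := fun x hx =>
    (continuous_neg_log_ofReal.tendsto (w x)).comp (hlim x hx)
  have hmonoV : Monotone fun j => weightedGreen E (weightPotential (wj j)) z := fun j k hjk =>
    weightedGreen_mono (fun x hx => hmono x hx hjk) z
  have hsup : weightedGreen E (weightPotential w) z =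
      ⨆ j, weightedGreen E (weightPotential (wj j)) z := by
    refine le_antisymm (iSup₂_le fun u hu => ?_) (iSup_le fun j =>
      weightedGreen_mono (fun x hx => (hmono x hx).ge_of_tendsto (hlimQ x hx) j) z)
    have hu_top : ∀ x, u x ≠ ⊤ := fun x => (hu.1.1.lt_top x (mem_univ x)).ne
    refine EReal.ge_of_forall_gt_iff_ge.1 fun c hc => ?_
    obtain ⟨r, hr⟩ : ∃ r : ℝ, u z = r :=
      ⟨(u z).toReal, (EReal.coe_toReal (hu_top z) (bot_le.trans_lt hc).ne').symm⟩
    have hcr : c < r := by rw [hr] at hc; exact_mod_cast hc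
    obtain ⟨j, hj⟩ := exists_forall_sub_le_of_tendsto hE (hu.1.1.usc.mono (subset_univ E))
      (fun x _ => hu_top x) (fun j => lowerSemicontinuousOn_weightPotential (hwj j).usc)
      (fun j x _ => weightPotential_ne_bot (wj j) x) hmono hlimQ hu.2 (sub_pos.2 hcr)
    calc (c : EReal) = u z - (r - c : ℝ) := by
          rw [hr, ← EReal.coe_sub, sub_sub_cancel]
      _ ≤ weightedGreen E (weightPotential (wj j)) z :=
          le_iSup₂_of_le (fun x => u x - (r - c : ℝ))
            ⟨sub_mem_lelongClass hu.1 (sub_pos.2 hcr).le, hj⟩ le_rfl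
      _ ≤ _ := le_iSup (fun j => weightedGreen E (weightPotential (wj j)) z) j
  rw [hsup]
  exact tendsto_atTop_iSup hmonoV
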